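/- **Setting.** Let $F:\mathbb R^n\to\mathbb R^n$ with $F(0)=0$, and consider $\dot x=F(x)$ with state space $\mathcal X\subseteq\mathbb R^n$, $0\in\mathcal X$; $\|\cdot\|$ is the Euclidean norm. A solution on an interval is a differentiable curve in $\mathcal X$ satisfying $\dot x(t)=F(x(t))$ at every $t$ of the interval. Let $r>0$, $\|x_c\|>\sqrt r$, suppose that the open ball of centre $x_c$ and radius $\sqrt r$ is contained in $\mathcal X$, and let the unsafe set be $\mathcal O=\{x\in\mathcal X\setminus\{0\}:\|x-x_c\|<\sqrt r\}$. Put $L(x)=\|x\|^2$, $B(x)=\eta_2-\eta_1\|x-x_c\|^2$, $V=\max(L,B)$, where $$\eta_1\ge\frac{\|x_c\|+\sqrt r}{\|x_c\|-\sqrt r},\qquad \eta_1 r+\max_{x\in\overline{\mathcal O}}\|x\|^2\le\eta_2<\eta_1\|x_c\|^2 .$$ Put $\mathcal R_1=\{x\in\mathcal X: B(x)>L(x),\,x\notin\mathcal O\}$, $\mathcal R_2=\{x\in\mathcal X:B(x)<L(x)\}$, $\mathcal R_3=\{x\in\mathcal X:B(x)=L(x)\}$, and $$d_1=\nabla B\cdot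 F,\qquad d_2=\nabla L\cdot F,\qquad d_3=\tfrac12(d_1+d_2)+\tfrac12|d_1-d_2| .$$ **Notions.** The upper generalized derivative is $\overline D_{\mathcal F}V(x)=\sup\{\langle\xi,F(x)\rangle:\xi\in\partial V(x)\}$, with $\partial V$ Clarke's generalized gradient. Class $\mathcal P$: continuous $\rho:[0,\infty)\to[0,\infty)$ with $\rho(0)=0$ and $\rho(s)>0$ for $s>0$. Class $\mathcal K_\infty$: strictly increasing unbounded functions in $\mathcal P$. Class $\mathcal{KL}$: functions $\beta(s,t)$ on $[0,\infty)^2$ that are $\mathcal K_\infty$ in $s$ for each $t\ge 0$ and, for each $s>0$, strictly decreasing to $0$ in $t$. A locally Lipschitz $V:\mathbb R^n\to\mathbb R$ is an NCLBF (nonsmooth control Lyapunov barrier function) if (a) there is a constant $c>0$ with $V=c$ on $\partial\mathcal O$ and $V\ge c$ on $\mathcal O$; (b) $\alpha_1(\|x\|)\le V(x)\le\alpha_2(\|x\|)$ on $\mathcal X$ for some $\alpha_1,\alpha_2\in\mathcal K_\infty$; (c) $\overline D_{\mathcal F}V(x)\le-\rho(\|x\|)$ on $\mathcal X\setminus(\mathcal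 O\cup\{0\})$ for some $\rho\in\mathcal P$. **Theorem.** 1. $V$ is locally Lipschitz and satisfies (a) and (b). 2. $\overline D_{\mathcal F}V(x)=d_i(x)$ for all $x\in\mathcal R_i$, $i=1,2,3$. 3. If there is $\rho\in\mathcal P$ with $\overline D_{\mathcal F}V(x)\le-\rho(\|x\|)$ for all $x\in\mathcal X\setminus(\mathcal O\cup\{0\})$, then $V$ is an NCLBF, and the system is $\mathcal{KL}$-stable and safe for all initial states $x(0)\in\mathcal X\setminus(\mathcal O\cup\mathcal R_1\cup\mathcal R_3)$. That is, there is one $\beta\in\mathcal{KL}$ such that every solution in $\mathcal X$ from such an initial state satisfies $\|x(t)\|\le\beta(\|x(0)\|,t)$ and $x(t)\notin\mathcal O$ at all times $t\ge0$ at which it is defined. Moreover, if $F$ is locally Lipschitz and the solutions in $\mathbb R^n$ from such an initial state cannot leave $\mathcal X$, then a solution from that state exists for all $t\ge0$. -/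

import Mathlib

open Set Filter Topology

namespace SafeStab

/-- The Euclidean space of dimension `n`, with the 2-norm. -/
abbrev Euc (n : ℕ) : Type := EuclideanSpace ℝ (Fin n)

/-! ### Comparison functions

Functions on the half line `[0, ∞)` are represented by functions on `ℝ`, of which only the
restriction to `[0, ∞)` matters. -/

/-- Class `P`: continuous on `[0, ∞)`, zero at `0`, positive on `(0, ∞)`. -/
def ClassP (ρ : ℝ → ℝ) : Prop :=
  ContinuousOn ρ (Ici 0) ∧ ρ 0 = 0 ∧ ∀ s, 0 < s → 0 < ρ s

/-- Class `K`: class `P` and strictly increasing on `[0, ∞)`. -/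
def ClassK (α : ℝ → ℝ) : Prop :=
  ClassP α ∧ StrictMonoOn α (Ici 0)

/-- Class `K_∞`: class `K` and unbounded. -/
def ClassKInf (α : ℝ → ℝ) : Prop :=
  ClassK α ∧ Tendsto α atTop atTop

/-- Class `L`: strictly decreasing on `[0, ∞)` with limit `0` at infinity. -/
def ClassL (σ : ℝ → ℝ) : Prop :=
  StrictAntiOn σ (Ici 0) ∧ Tendsto σ atTop (𝓝 0)

/-- Class `KL`: class `K_∞` in the first variable, and class `L` in the second one. (For `s = 0`
the function `β 0` vanishes on `[0, ∞)`, so strict decrease makes sense for `s > 0` only.) -/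
def ClassKL (β : ℝ → ℝ → ℝ) : Prop :=
  (∀ t, 0 ≤ t → ClassKInf (fun s => β s t)) ∧ ∀ s, 0 < s → ClassL (β s)

/-! ### Generalized gradient and upper generalized derivative -/

/-- Limits of gradients of `h` along sequences of points of differentiability tending to `x`. -/
def limitingGradients {n : ℕ} (h : Euc n → ℝ) (x : Euc n) : Set (Euc n) :=
  {ξ | ∃ u : ℕ → Euc n, (∀ k, DifferentiableAt ℝ h (u k)) ∧ Tendsto u atTop (𝓝 x) ∧
    Tendsto (fun k => gradient h (u k)) atTop (𝓝 ξ)}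

/-- Clarke's generalized gradient of a (locally Lipschitz) function on a Euclidean space. -/
def generalizedGradient {n : ℕ} (h : Euc n → ℝ) (x : Euc n) : Set (Euc n) :=
  convexHull ℝ (limitingGradients h x)

/-- The set-valued Lie derivative of `h` along the set-valued map `𝓕`. -/
def lieDerivative {n : ℕ} (𝓕 : Euc n → Set (Euc n)) (h : Euc n → ℝ) (x : Euc n) : Set ℝ :=
  {a | ∃ v ∈ 𝓕 x, ∃ ξ ∈ generalizedGradient h x, a = inner ℝ ξ v}

/-- The upper generalized derivative: the supremum of the set-valued Lie derivative, taken in the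
extended reals. -/
noncomputable def upperGenDeriv {n : ℕ} (𝓕 : Euc n → Set (Euc n)) (h : Euc n → ℝ) (x : Euc n) :
    EReal :=
  sSup ((fun a : ℝ => (a : EReal)) '' lieDerivative 𝓕 h x)

/-- The set-valued map `x ↦ {F x}` of the system `ẋ = F(x)`. -/
def singleValued {n : ℕ} (F : Euc n → Euc n) : Euc n → Set (Euc n) :=
  fun x => {F x}

/-! ### Nonsmooth control Lyapunov barrier functions -/

/-- The conditions on an NCLBF that do not involve the dynamics: `V` is locally Lipschitz, each
unsafe set `O i` has a constant `c i > 0` such that `V = c i` on its boundary and `V ≥ c i` on it,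
and `V` lies between two `K_∞` functions of the distance to `xg` on the state space. -/
def IsNCLBFCandidate {n N : ℕ} (X : Set (Euc n)) (xg : Euc n) (O : Fin N → Set (Euc n))
    (V : Euc n → ℝ) : Prop :=
  LocallyLipschitz V ∧
  (∃ c : Fin N → ℝ, ∀ i, 0 < c i ∧ (∀ x ∈ frontier (O i), V x = c i) ∧ ∀ x ∈ O i, c i ≤ V x) ∧
  ∃ α₁ α₂ : ℝ → ℝ, ClassKInf α₁ ∧ ClassKInf α₂ ∧
    ∀ x ∈ X, α₁ ‖x - xg‖ ≤ V x ∧ V x ≤ α₂ ‖x - xg‖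

/-- The decrease condition with rate `ρ`, outside the unsafe set `O` and away from `xg`. -/
def Decreases {n : ℕ} (𝓕 : Euc n → Set (Euc n)) (X : Set (Euc n)) (xg : Euc n)
    (O : Set (Euc n)) (V : Euc n → ℝ) (ρ : ℝ → ℝ) : Prop :=
  ∀ x ∈ X \ (O ∪ {xg}), upperGenDeriv 𝓕 V x ≤ ((-ρ ‖x‖ : ℝ) : EReal)

/-- `V` is an NCLBF for the dynamics `𝓕` on the state space `X`, with desired equilibrium `xg` and
unsafe sets `O i`. -/
def IsNCLBF {n N : ℕ} (𝓕 : Euc n → Set (Euc n)) (X : Set (Euc n)) (xg : Euc n)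
    (O : Fin N → Set (Euc n)) (V : Euc n → ℝ) : Prop :=
  IsNCLBFCandidate X xg O V ∧ ∃ ρ : ℝ → ℝ, ClassP ρ ∧ Decreases 𝓕 X xg (⋃ i, O i) V ρ

/-! ### Solutions, stability and safety -/

/-- `x` solves `ẋ = F(x)` on the time set `J` and stays in the state space `X` during `J`. -/
def IsSolution {n : ℕ} (F : Euc n → Euc n) (X : Set (Euc n)) (J : Set ℝ) (x : ℝ → Euc n) : Prop :=
  ∀ t ∈ J, x t ∈ X ∧ HasDerivWithinAt x (F (x t)) J t

/-- No solution of `ẋ = F(x)` in the whole space that starts at `x₀` ever leaves `X`. -/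
def StaysIn {n : ℕ} (F : Euc n → Euc n) (X : Set (Euc n)) (x₀ : Euc n) : Prop :=
  ∀ (T : ℝ) (x : ℝ → Euc n), 0 ≤ T → IsSolution F univ (Icc 0 T) x → x 0 = x₀ →
    ∀ t ∈ Icc 0 T, x t ∈ X

/-- `ẋ = F(x)` with state space `X` is `KL`-stable with respect to the origin and safe with respect
to `O`, for initial states in `S`: with one `KL` function `β`, every solution in `X` that starts in
`S` satisfies the `KL` bound and avoids `O` for as long as it exists; and if `F` is locally
Lipschitz and the solutions from an initial state in `S` cannot leave `X`, then a solution from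
that state does exist for all times `t ≥ 0`. -/
def IsKLStableAndSafe {n : ℕ} (F : Euc n → Euc n) (X O S : Set (Euc n)) : Prop :=
  ∃ β : ℝ → ℝ → ℝ, ClassKL β ∧ ∀ x₀ ∈ S,
    (∀ (T : ℝ) (x : ℝ → Euc n), 0 ≤ T → IsSolution F X (Icc 0 T) x → x 0 = x₀ →
      ∀ t ∈ Icc 0 T, ‖x t‖ ≤ β ‖x₀‖ t ∧ x t ∉ O) ∧
    (LocallyLipschitz F → StaysIn F X x₀ →
      ∃ x : ℝ → Euc n, IsSolution F X (Ici 0) x ∧ x 0 = x₀)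

/-! ### One ball-shaped unsafe set -/

/-- The unsafe set: the points of `X \ {0}` at distance less than `√r` from `xc`. -/
def unsafeBall {n : ℕ} (X : Set (Euc n)) (xc : Euc n) (r : ℝ) : Set (Euc n) :=
  {x | x ∈ X \ {0} ∧ ‖x - xc‖ < √r}

/-- `L(x) = ‖x‖²`. -/
noncomputable def lyapL {n : ℕ} (x : Euc n) : ℝ := ‖x‖ ^ 2

/-- `B(x) = η₂ - η₁ ‖x - xc‖²`. -/
noncomputable def barB {n : ℕ} (xc : Euc n) (η₁ η₂ : ℝ) (x : Euc n) : ℝ :=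
  η₂ - η₁ * ‖x - xc‖ ^ 2

/-- `V(x) = max (L(x), B(x))`. -/
noncomputable def maxV {n : ℕ} (xc : Euc n) (η₁ η₂ : ℝ) (x : Euc n) : ℝ :=
  max (lyapL x) (barB xc η₁ η₂ x)

/-- The points of `X` outside the unsafe set where `B > L`. -/
def region₁ {n : ℕ} (X : Set (Euc n)) (xc : Euc n) (r η₁ η₂ : ℝ) : Set (Euc n) :=
  {x | x ∈ X ∧ lyapL x < barB xc η₁ η₂ x ∧ x ∉ unsafeBall X xc r}

/-- The points of `X` where `B < L`. -/
def region₂ {n : ℕ} (X : Set (Euc n)) (xc : Euc n) (η₁ η₂ : ℝ) : Set (Euc n) :=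
  {x | x ∈ X ∧ barB xc η₁ η₂ x < lyapL x}

/-- The points of `X` where `B = L`. -/
def region₃ {n : ℕ} (X : Set (Euc n)) (xc : Euc n) (η₁ η₂ : ℝ) : Set (Euc n) :=
  {x | x ∈ X ∧ barB xc η₁ η₂ x = lyapL x}

/-- `d₁ = ∇B · F`. -/
noncomputable def deriv₁ {n : ℕ} (F : Euc n → Euc n) (xc : Euc n) (η₁ η₂ : ℝ) (x : Euc n) : ℝ :=
  inner ℝ (gradient (barB xc η₁ η₂) x) (F x)

/-- `d₂ = ∇L · F`. -/
noncomputable def deriv₂ {n : ℕ} (F : Euc n → Euc n) (x : Euc n) : ℝ :=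
  inner ℝ (gradient lyapL x) (F x)

/-- `d₃ = (d₁ + d₂) / 2 + |d₁ - d₂| / 2`. -/
noncomputable def deriv₃ {n : ℕ} (F : Euc n → Euc n) (xc : Euc n) (η₁ η₂ : ℝ) (x : Euc n) : ℝ :=
  (1 / 2) * (deriv₁ F xc η₁ η₂ x + deriv₂ F x) + (1 / 2) * |deriv₁ F xc η₁ η₂ x - deriv₂ F x|

end SafeStab

/-!
The gradient of a maximum of two `C¹` functions at a point of differentiability is the gradient of
an active function. Hence the generalized gradient of `V = max (L, B)` is a single gradient where
`B ≠ L`, and where `B = L` it is the segment between `∇L` and `∇B`: these differ there, because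
`B - L` is concave with a positive maximum, so both strict inequalities occur arbitrarily nearby.
The formulas for the upper generalized derivative follow (`upperGenDeriv_maxV_of_lt` and its
companions; `d₃` is just `max (d₁, d₂)`).

The decrease condition therefore says that, outside the unsafe set, `d₂ ≤ -ρ` where `L ≥ B` and
`d₁ ≤ -ρ` where `B ≥ L` (`Decreases.deriv₂_le`, `Decreases.deriv₁_le`). The choice of `η₂` makes
`B ≥ L` on the sphere bounding the unsafe set, so that the distance to `xc` is strictly increasing
there and no solution can enter the ball (`IsSolution.le_norm_sub`).

For stability, the upper right Dini derivative of `V` along a solution is at most `-ρ(‖x‖)`. As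
`‖x‖² ≤ V ≤ ‖x‖² + 2k‖x‖`, the rate `ρ(‖x‖)` is bounded below by a positive continuous function of
`V`, and `V` stays below `exp (2y)` for a solution `y` of a scalar equation `y' = -1 / q(y)` with
`q ≥ 1` (`ClassP.exists_slow_rate`, `IsSolution.norm_le_flowKL`). That equation is solved by the
inverse of `H(y) = ∫₀^y q`, an increasing bijection of `ℝ`, and `exp (H⁻¹ (H (log s) - t))` is the
`KL` function. The initial states under consideration are those with `B < L`, where `V = ‖x‖²`.

Global existence: the `KL` bound confines the solutions to a ball, on which `F` may be replaced by a
bounded and globally Lipschitz vector field; for such a field the Picard-Lindelöf theorem applies on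
intervals of any length (`exists_isSolution_Ici`).
-/

namespace SafeStab

/-! ### The generalized gradient of a maximum of two smooth functions -/

section Clarke

variable {n : ℕ}

lemma gradient_eq_of_le_of_eq {f V : Euc n → ℝ} {u a : Euc n} (hle : ∀ y, f y ≤ V y)
    (heq : V u = f u) (hf : HasGradientAt f a u) (hV : DifferentiableAt ℝ V u) :
    gradient V u = a := by
  have hmin : IsLocalMin (fun y => V y - f y) u :=
    Eventually.of_forall fun y => by
      have := hle y
      simp only [heq, sub_self]
      linarith
  have h0 := hmin.hasFDerivAt_eq_zero (hV.hasGradientAt.hasFDerivAt.sub hf.hasFDerivAt)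
  rw [sub_eq_zero] at h0
  exact (InnerProductSpace.toDual ℝ (Euc n)).injective h0

variable {f g : Euc n → ℝ} {f' g' : Euc n → Euc n}

/-- At a point where the maximum is differentiable its gradient is that of an active function, so
every limiting gradient is the gradient of a function active at the limit. -/
lemma limitingGradients_max_subset (hf : ∀ x, HasGradientAt f (f' x) x)
    (hg : ∀ x, HasGradientAt g (g' x) x) (cf : Continuous f') (cg : Continuous g') {x ξ : Euc n}
    (hξ : ξ ∈ limitingGradients (fun y => max (f y) (g y)) x) :
    (ξ = f' x ∧ g x ≤ f x) ∨ (ξ = g' x ∧ f x ≤ g x) := by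
  obtain ⟨u, hd, hu, hgrad⟩ := hξ
  have hf0 : Continuous f := continuous_iff_continuousAt.2 fun y => (hf y).continuousAt
  have hg0 : Continuous g := continuous_iff_continuousAt.2 fun y => (hg y).continuousAt
  have key : ∀ (p q : Euc n → ℝ) (p' : Euc n → Euc n), Continuous p → Continuous q →
      Continuous p' → (∃ᶠ k in atTop, q (u k) ≤ p (u k) ∧
        gradient (fun y => max (f y) (g y)) (u k) = p' (u k)) → ξ = p' x ∧ q x ≤ p x := by
    intro p q p' hp hq hp' hfr
    have hcl : IsClosed {z : Euc n × Euc n | z.2 = p' z.1 ∧ q z.1 ≤ p z.1} :=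
      (isClosed_eq continuous_snd (hp'.comp continuous_fst)).inter
        (isClosed_le (hq.comp continuous_fst) (hp.comp continuous_fst))
    exact hcl.mem_of_frequently_of_tendsto (hfr.mono fun k hk => ⟨hk.2, hk.1⟩)
      (hu.prodMk_nhds hgrad)
  have hor : ∃ᶠ k in atTop, g (u k) ≤ f (u k) ∨ f (u k) ≤ g (u k) :=
    (Eventually.of_forall fun k => le_total _ _).frequently
  rcases frequently_or_distrib.1 hor with h | h
  · exact Or.inl (key f g f' hf0 hg0 cf (h.mono fun k hk => ⟨hk,
      gradient_eq_of_le_of_eq (fun y => le_max_left _ _) (max_eq_left hk) (hf _) (hd k)⟩))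
  · exact Or.inr (key g f g' hg0 hf0 cg (h.mono fun k hk => ⟨hk,
      gradient_eq_of_le_of_eq (fun y => le_max_right _ _) (max_eq_right hk) (hg _) (hd k)⟩))

lemma mem_limitingGradients_max_left (hf : ∀ x, HasGradientAt f (f' x) x) (cg : Continuous g)
    (cf : Continuous f') {x : Euc n} (hx : x ∈ closure {y | g y < f y}) :
    f' x ∈ limitingGradients (fun y => max (f y) (g y)) x := by
  obtain ⟨u, hu, hux⟩ := mem_closure_iff_seq_limit.1 hx
  have hf0 : Continuous f := continuous_iff_continuousAt.2 fun y => (hf y).continuousAt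
  have hgr : ∀ k, HasGradientAt (fun y => max (f y) (g y)) (f' (u k)) (u k) := fun k => by
    refine (hf (u k)).congr_of_eventuallyEq ?_
    filter_upwards [(isOpen_lt cg hf0).mem_nhds (hu k)] with y hy
    exact max_eq_left (le_of_lt hy)
  refine ⟨u, fun k => (hgr k).differentiableAt, hux, ?_⟩
  simp_rw [fun k => (hgr k).gradient]
  exact (cf.tendsto x).comp hux

lemma mem_limitingGradients_max_right (hg : ∀ x, HasGradientAt g (g' x) x) (cf : Continuous f)
    (cg : Continuous g') {x : Euc n} (hx : x ∈ closure {y | f y < g y}) :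
    g' x ∈ limitingGradients (fun y => max (f y) (g y)) x := by
  simp_rw [max_comm (f _)]
  exact mem_limitingGradients_max_left hg cf cg hx

/-- Where two functions agree but have different gradients, neither dominates the other nearby. -/
lemma mem_closure_lt_of_gradient_ne {x a b : Euc n} (hf : HasGradientAt f a x)
    (hg : HasGradientAt g b x) (heq : f x = g x) (hne : a ≠ b) : x ∈ closure {y | g y < f y} := by
  by_contra hx
  have hmin : IsLocalMin (fun y => g y - f y) x := by
    filter_upwards [isClosed_closure.isOpen_compl.mem_nhds hx] with y hy
    have : ¬ g y < f y := fun h => hy (subset_closure h)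
    simp only [heq, sub_self]
    linarith
  have h0 := hmin.hasFDerivAt_eq_zero (hg.hasFDerivAt.sub hf.hasFDerivAt)
  rw [sub_eq_zero] at h0
  exact hne ((InnerProductSpace.toDual ℝ (Euc n)).injective h0).symm

/-- The supremum of a linear form over a segment is attained at an end point. -/
lemma upperGenDeriv_of_limitingGradients_eq_pair (F : Euc n → Euc n) {h : Euc n → ℝ}
    {x a b : Euc n} (hab : limitingGradients h x = {a, b}) :
    upperGenDeriv (singleValued F) h x =
      ((max (inner ℝ a (F x)) (inner ℝ b (F x)) : ℝ) : EReal) := by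
  have hsub : ({a, b} : Set (Euc n)) ⊆ generalizedGradient h x :=
    hab ▸ subset_convexHull ℝ _
  apply le_antisymm
  · apply sSup_le
    rintro _ ⟨_, ⟨v, rfl, ξ, hξ, rfl⟩, rfl⟩
    rw [generalizedGradient, hab, convexHull_pair] at hξ
    obtain ⟨s, t, hs, ht, hst, rfl⟩ := hξ
    rw [EReal.coe_le_coe_iff, inner_add_left, real_inner_smul_left, real_inner_smul_left]
    calc s * inner ℝ a (F x) + t * inner ℝ b (F x)
        ≤ s * max (inner ℝ a (F x)) (inner ℝ b (F x))
          + t * max (inner ℝ a (F x)) (inner ℝ b (F x)) := by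
          gcongr
          · exact le_max_left _ _
          · exact le_max_right _ _
      _ = _ := by rw [← add_mul, hst, one_mul]
  · apply le_sSup
    rcases max_choice (inner ℝ a (F x)) (inner ℝ b (F x)) with hm | hm <;> rw [hm]
    · exact ⟨_, ⟨F x, rfl, a, hsub (by simp), rfl⟩, rfl⟩
    · exact ⟨_, ⟨F x, rfl, b, hsub (by simp), rfl⟩, rfl⟩

variable (F : Euc n → Euc n)

lemma upperGenDeriv_max_of_lt (hf : ∀ x, HasGradientAt f (f' x) x)
    (hg : ∀ x, HasGradientAt g (g' x) x) (cf : Continuous f') (cg : Continuous g') {x : Euc n}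
    (hx : g x < f x) :
    upperGenDeriv (singleValued F) (fun y => max (f y) (g y)) x =
      ((inner ℝ (f' x) (F x) : ℝ) : EReal) := by
  have hg0 : Continuous g := continuous_iff_continuousAt.2 fun y => (hg y).continuousAt
  rw [upperGenDeriv_of_limitingGradients_eq_pair F (a := f' x) (b := f' x), max_self]
  ext ξ
  constructor
  · intro h
    rcases limitingGradients_max_subset hf hg cf cg h with h | h
    · simp [h.1]
    · exact absurd h.2 (not_le.2 hx)
  · intro h
    obtain rfl : ξ = f' x := by simpa using h
    exact mem_limitingGradients_max_left hf hg0 cf (subset_closure hx)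

lemma upperGenDeriv_max_of_eq (hf : ∀ x, HasGradientAt f (f' x) x)
    (hg : ∀ x, HasGradientAt g (g' x) x) (cf : Continuous f') (cg : Continuous g') {x : Euc n}
    (hx : f x = g x) (hne : f' x ≠ g' x) :
    upperGenDeriv (singleValued F) (fun y => max (f y) (g y)) x =
      ((max (inner ℝ (f' x) (F x)) (inner ℝ (g' x) (F x)) : ℝ) : EReal) := by
  have hf0 : Continuous f := continuous_iff_continuousAt.2 fun y => (hf y).continuousAt
  have hg0 : Continuous g := continuous_iff_continuousAt.2 fun y => (hg y).continuousAt
  apply upperGenDeriv_of_limitingGradients_eq_pair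
  ext ξ
  constructor
  · intro h
    rcases limitingGradients_max_subset hf hg cf cg h with h | h <;> simp [h.1]
  · rintro (rfl | rfl)
    · exact mem_limitingGradients_max_left hf hg0 cf
        (mem_closure_lt_of_gradient_ne (hf x) (hg x) hx hne)
    · exact mem_limitingGradients_max_right hg hf0 cg
        (mem_closure_lt_of_gradient_ne (hg x) (hf x) hx.symm hne.symm)

end Clarke

/-! ### The functions `L`, `B` and `V` -/

section MaxV

variable {n : ℕ}

lemma hasGradientAt_lyapL (x : Euc n) : HasGradientAt lyapL ((2 : ℝ) • x) x := by
  rw [hasGradientAt_iff_hasFDerivAt]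
  have h := (hasStrictFDerivAt_norm_sq x).hasFDerivAt
  refine HasFDerivAt.congr_fderiv (f := lyapL) h ?_
  ext v
  simp

lemma hasGradientAt_barB (xc : Euc n) (η₁ η₂ : ℝ) (x : Euc n) :
    HasGradientAt (barB xc η₁ η₂) (-(2 * η₁) • (x - xc)) x := by
  rw [hasGradientAt_iff_hasFDerivAt]
  have h := (((hasStrictFDerivAt_norm_sq (x - xc)).hasFDerivAt.comp x
    ((hasFDerivAt_id x).sub_const xc)).const_mul η₁).const_sub η₂
  refine HasFDerivAt.congr_fderiv (f := barB xc η₁ η₂) h ?_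
  ext v
  simp
  ring

lemma maxV_eq (xc : Euc n) (η₁ η₂ : ℝ) :
    maxV xc η₁ η₂ = fun x => max (lyapL x) (barB xc η₁ η₂ x) := rfl

lemma maxV_eq_swap (xc : Euc n) (η₁ η₂ : ℝ) :
    maxV xc η₁ η₂ = fun x => max (barB xc η₁ η₂ x) (lyapL x) := by
  funext x
  exact max_comm _ _

lemma continuous_lyapL : Continuous (lyapL : Euc n → ℝ) := by
  unfold lyapL; fun_prop

lemma continuous_barB (xc : Euc n) (η₁ η₂ : ℝ) : Continuous (barB xc η₁ η₂) := by
  unfold barB; fun_prop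

lemma deriv₁_eq (F : Euc n → Euc n) (xc : Euc n) (η₁ η₂ : ℝ) (x : Euc n) :
    deriv₁ F xc η₁ η₂ x = inner ℝ (-(2 * η₁) • (x - xc)) (F x) := by
  rw [deriv₁, (hasGradientAt_barB xc η₁ η₂ x).gradient]

lemma deriv₂_eq (F : Euc n → Euc n) (x : Euc n) :
    deriv₂ F x = inner ℝ ((2 : ℝ) • x) (F x) := by
  rw [deriv₂, (hasGradientAt_lyapL x).gradient]

lemma deriv₃_eq_max (F : Euc n → Euc n) (xc : Euc n) (η₁ η₂ : ℝ) (x : Euc n) :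
    deriv₃ F xc η₁ η₂ x = max (deriv₂ F x) (deriv₁ F xc η₁ η₂ x) := by
  rw [deriv₃]
  rcases le_total (deriv₂ F x) (deriv₁ F xc η₁ η₂ x) with h | h
  · rw [max_eq_right h, abs_of_nonneg (sub_nonneg.2 h)]
    ring
  · rw [max_eq_left h, abs_of_nonpos (sub_nonpos.2 h)]
    ring

lemma upperGenDeriv_maxV_of_lt (F : Euc n → Euc n) {xc : Euc n} {η₁ η₂ : ℝ} {x : Euc n}
    (hx : lyapL x < barB xc η₁ η₂ x) :
    upperGenDeriv (singleValued F) (maxV xc η₁ η₂) x = ((deriv₁ F xc η₁ η₂ x : ℝ) : EReal) := by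
  rw [maxV_eq_swap, deriv₁_eq]
  exact upperGenDeriv_max_of_lt F (hasGradientAt_barB xc η₁ η₂) hasGradientAt_lyapL
    (by fun_prop) (by fun_prop) hx

lemma upperGenDeriv_maxV_of_gt (F : Euc n → Euc n) {xc : Euc n} {η₁ η₂ : ℝ} {x : Euc n}
    (hx : barB xc η₁ η₂ x < lyapL x) :
    upperGenDeriv (singleValued F) (maxV xc η₁ η₂) x = ((deriv₂ F x : ℝ) : EReal) := by
  rw [maxV_eq, deriv₂_eq]
  exact upperGenDeriv_max_of_lt F hasGradientAt_lyapL (hasGradientAt_barB xc η₁ η₂)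
    (by fun_prop) (by fun_prop) hx

/-- `∇L = ∇B` only at `z = η₁ / (1 + η₁) xc`, the maximum point of the concave function `B - L`,
which is positive there because it is positive at `xc`. -/
lemma gradient_lyapL_ne_gradient_barB {xc : Euc n} {η₁ η₂ : ℝ} (hη₁ : 0 < η₁)
    (hη₂ : ‖xc‖ ^ 2 < η₂) {x : Euc n} (hx : barB xc η₁ η₂ x = lyapL x) :
    (2 : ℝ) • x ≠ -(2 * η₁) • (x - xc) := by
  intro h
  have h1 : x = -η₁ • (x - xc) := by
    have : (2 : ℝ) • x = (2 : ℝ) • (-η₁ • (x - xc)) := by rw [h, smul_smul]; ring_nf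
    exact smul_right_injective _ (two_ne_zero) this
  set d := x - xc with hd
  have hxc : xc = -(1 + η₁) • d := by
    have : xc = x - d := by rw [hd]; abel
    rw [this, h1]; module
  have e1 : ‖x‖ ^ 2 = η₁ ^ 2 * ‖d‖ ^ 2 := by
    rw [h1, norm_smul, mul_pow]; simp
  have e2 : ‖xc‖ ^ 2 = (1 + η₁) ^ 2 * ‖d‖ ^ 2 := by
    rw [hxc, norm_smul, mul_pow, Real.norm_eq_abs, sq_abs]; ring
  simp only [barB, lyapL, ← hd] at hx
  have := sq_nonneg ‖d‖
  nlinarith [mul_nonneg hη₁.le (sq_nonneg ‖d‖)]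

lemma upperGenDeriv_maxV_of_eq (F : Euc n → Euc n) {xc : Euc n} {η₁ η₂ : ℝ} (hη₁ : 0 < η₁)
    (hη₂ : ‖xc‖ ^ 2 < η₂) {x : Euc n} (hx : barB xc η₁ η₂ x = lyapL x) :
    upperGenDeriv (singleValued F) (maxV xc η₁ η₂) x = ((deriv₃ F xc η₁ η₂ x : ℝ) : EReal) := by
  rw [maxV_eq, deriv₃_eq_max, deriv₁_eq, deriv₂_eq]
  exact upperGenDeriv_max_of_eq F hasGradientAt_lyapL (hasGradientAt_barB xc η₁ η₂)
    (by fun_prop) (by fun_prop) hx.symm (gradient_lyapL_ne_gradient_barB hη₁ hη₂ hx)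

lemma locallyLipschitz_maxV (xc : Euc n) (η₁ η₂ : ℝ) : LocallyLipschitz (maxV xc η₁ η₂) := by
  have hL : ContDiff ℝ 1 (lyapL : Euc n → ℝ) := contDiff_norm_sq ℝ
  have hB : ContDiff ℝ 1 (barB xc η₁ η₂) :=
    contDiff_const.sub (contDiff_const.mul ((contDiff_id.sub contDiff_const).norm_sq ℝ))
  exact hL.locallyLipschitz.max hB.locallyLipschitz

/-- Since `η₂ ≤ η₁ ‖xc‖²`, the barrier lies below its linear part at the origin. -/
lemma maxV_le {xc : Euc n} {η₁ η₂ : ℝ} (hη₁ : 0 ≤ η₁) (hη₂ : η₂ ≤ η₁ * ‖xc‖ ^ 2) (x : Euc n) :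
    maxV xc η₁ η₂ x ≤ ‖x‖ ^ 2 + 2 * (η₁ * ‖xc‖) * ‖x‖ := by
  apply max_le
  · have : 0 ≤ 2 * (η₁ * ‖xc‖) * ‖x‖ := by positivity
    simpa [lyapL] using this
  · rw [barB, norm_sub_sq_real]
    have h1 := real_inner_le_norm x xc
    nlinarith [mul_le_mul_of_nonneg_left h1 hη₁, mul_nonneg hη₁ (sq_nonneg ‖x‖), sq_nonneg ‖x‖]

end MaxV

/-! ### Comparison functions -/

/-- Here `s` stands for `‖x‖` and `exp y ^ 2` for the value of `V` at `x`. Along a solution of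
`y' = -1 / q y` the function `exp y ^ 2` has the derivative `-2 * exp y ^ 2 / q y`, and the conclusion
says that this is a slower decrease than the rate `ρ s`. -/
lemma ClassP.exists_slow_rate {ρ : ℝ → ℝ} (hρ : ClassP ρ) {k : ℝ} (hk : 0 ≤ k) :
    ∃ q : ℝ → ℝ, Continuous q ∧ (∀ y, 1 ≤ q y) ∧ ∀ y s, 0 ≤ s → s ≤ Real.exp y →
      Real.exp y ^ 2 ≤ s ^ 2 + 2 * k * s → 2 * Real.exp y ^ 2 < q y * ρ s := by
  obtain ⟨hc, -, hpos⟩ := hρ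
  -- the nonnegative root of `s ^ 2 + 2 * k * s = exp y ^ 2`
  set lo : ℝ → ℝ := fun y => √(Real.exp y ^ 2 + k ^ 2) - k with hlo
  have lo_pos : ∀ y, 0 < lo y := fun y => by
    have : k < √(Real.exp y ^ 2 + k ^ 2) :=
      Real.lt_sqrt_of_sq_lt (by have := Real.exp_pos y; nlinarith)
    simpa [hlo] using this
  have lo_le : ∀ y s, 0 ≤ s → Real.exp y ^ 2 ≤ s ^ 2 + 2 * k * s → lo y ≤ s := fun y s hs h => by
    have : √(Real.exp y ^ 2 + k ^ 2) ≤ s + k :=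
      Real.sqrt_le_iff.2 ⟨by positivity, by nlinarith⟩
    simpa [hlo] using this
  have lo_le_exp : ∀ y, lo y ≤ Real.exp y := fun y =>
    lo_le y _ (Real.exp_pos y).le (by nlinarith [mul_nonneg hk (Real.exp_pos y).le])
  set p : ℝ → ℝ → ℝ := fun y θ => ρ (max 0 (lo y + θ * (Real.exp y - lo y))) with hp
  have lo_cont : Continuous lo := by fun_prop
  have p_cont : Continuous (fun z : ℝ × ℝ => p z.1 z.2) := by
    refine hc.comp_continuous (f := fun z : ℝ × ℝ =>
      max 0 (lo z.1 + z.2 * (Real.exp z.1 - lo z.1))) (by fun_prop) fun z => ?_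
    exact mem_Ici.2 (le_max_left (0 : ℝ) _)
  set m : ℝ → ℝ := fun y => sInf (p y '' Icc 0 1) with hm
  have m_cont : Continuous m := isCompact_Icc.continuous_sInf p_cont
  have p_cont' : ∀ y, ContinuousOn (p y) (Icc 0 1) := fun y =>
    (p_cont.comp (by fun_prop : Continuous fun θ : ℝ => (y, θ))).continuousOn
  have m_pos : ∀ y, 0 < m y := fun y => by
    obtain ⟨θ, hθ, he⟩ := isCompact_Icc.exists_sInf_image_eq (nonempty_Icc.2 zero_le_one)
      (p_cont' y)
    rw [hm]
    simp only
    rw [he]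
    refine hpos _ (lt_max_of_lt_right ?_)
    have := mul_nonneg hθ.1 (sub_nonneg.2 (lo_le_exp y))
    linarith [lo_pos y]
  have m_le : ∀ y s, lo y ≤ s → s ≤ Real.exp y → m y ≤ ρ s := fun y s h1 h2 => by
    refine csInf_le (isCompact_Icc.image_of_continuousOn (p_cont' y)).bddBelow ?_
    have hseg : s ∈ segment ℝ (lo y) (Real.exp y) := by
      rw [segment_eq_Icc (lo_le_exp y)]; exact ⟨h1, h2⟩
    rw [segment_eq_image'] at hseg
    obtain ⟨θ, hθ, rfl⟩ := hseg
    refine ⟨θ, hθ, ?_⟩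
    rw [hp]
    simp only [smul_eq_mul] at h1 ⊢
    rw [max_eq_right ((lo_pos y).le.trans h1)]
  refine ⟨fun y => 1 + 2 * Real.exp y ^ 2 / m y, ?_, fun y => ?_, fun y s hs h1 h2 => ?_⟩
  · exact continuous_const.add (Continuous.div (by fun_prop) m_cont fun y => (m_pos y).ne')
  · have := m_pos y
    have : 0 ≤ 2 * Real.exp y ^ 2 / m y := by positivity
    linarith
  · have hms := m_le y s (lo_le y s hs h2) h1
    have hmy := m_pos y
    have : 2 * Real.exp y ^ 2 ≤ 2 * Real.exp y ^ 2 / m y * ρ s := by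
      rw [div_mul_eq_mul_div, le_div_iff₀ hmy]
      gcongr
    linarith

lemma exists_orderIso_hasDerivAt {q : ℝ → ℝ} (hq : Continuous q) (h1 : ∀ y, 1 ≤ q y) :
    ∃ H : ℝ ≃o ℝ, ∀ z, HasDerivAt H.symm (q (H.symm z))⁻¹ z := by
  set H : ℝ → ℝ := fun y => ∫ u in (0 : ℝ)..y, q u with hH
  have hd : ∀ y, HasDerivAt H (q y) y := fun y => hq.integral_hasStrictDerivAt 0 y |>.hasDerivAt
  have hq0 : ∀ y, 0 < q y := fun y => zero_lt_one.trans_le (h1 y)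
  have hmono : StrictMono H := strictMono_of_hasDerivAt_pos hd hq0
  have hgrow : Monotone fun y => H y - y :=
    monotone_of_hasDerivAt_nonneg (fun y => (hd y).sub (hasDerivAt_id y)) fun y =>
      sub_nonneg.2 (h1 y)
  have h00 : H 0 = 0 := by simp [hH]
  have hcont : Continuous H := continuous_iff_continuousAt.2 fun y => (hd y).continuousAt
  have htop : Tendsto H atTop atTop :=
    tendsto_atTop_mono' _ ((eventually_ge_atTop 0).mono fun y hy => by
      have := hgrow hy
      simp only [h00] at this
      simp only [id]
      linarith) tendsto_id
  have hbot : Tendsto H atBot atBot :=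
    tendsto_atBot_mono' _ ((eventually_le_atBot 0).mono fun y hy => by
      have := hgrow hy
      simp only [h00] at this
      simp only [id]
      linarith) tendsto_id
  let e := hmono.orderIsoOfSurjective H (hcont.surjective htop hbot)
  refine ⟨e, fun z => ?_⟩
  exact HasDerivAt.of_local_left_inverse e.symm.continuous.continuousAt (hd _) (hq0 _).ne'
    (Eventually.of_forall fun y => e.apply_symm_apply y)

/-- The `KL` function that belongs to the scalar equation `y' = -1 / q y`: its value at `(s, t)` is
`exp (y t)` for the solution `y` with `exp (y 0) = s`. -/
noncomputable def flowKL (H : ℝ ≃o ℝ) (s t : ℝ) : ℝ :=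
  if 0 < s then Real.exp (H.symm (H (Real.log s) - t)) else 0

lemma flowKL_of_pos (H : ℝ ≃o ℝ) {s : ℝ} (hs : 0 < s) (t : ℝ) :
    flowKL H s t = Real.exp (H.symm (H (Real.log s) - t)) := if_pos hs

lemma flowKL_zero (H : ℝ ≃o ℝ) (t : ℝ) : flowKL H 0 t = 0 := if_neg (lt_irrefl 0)

lemma classKL_flowKL (H : ℝ ≃o ℝ) : ClassKL (flowKL H) := by
  refine ⟨fun t _ => ⟨⟨⟨?_, flowKL_zero H t, fun s hs => ?_⟩, ?_⟩, ?_⟩, fun s hs => ⟨?_, ?_⟩⟩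
  · intro s hs
    rcases (mem_Ici.1 hs).eq_or_lt with rfl | hs
    · rw [← continuousWithinAt_Ioi_iff_Ici, ContinuousWithinAt, flowKL_zero]
      have h : Tendsto (fun s => Real.exp (H.symm (H (Real.log s) - t))) (𝓝[>] 0) (𝓝 0) :=
        Real.tendsto_exp_atBot.comp (H.symm.tendsto_atBot.comp
          (tendsto_atBot_add_const_right _ _ (H.tendsto_atBot.comp Real.tendsto_log_nhdsGT_zero)))
      refine h.congr' ?_
      filter_upwards [self_mem_nhdsWithin] with s hs
      exact (flowKL_of_pos H hs t).symm
    · refine ContinuousAt.continuousWithinAt ?_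
      have h : ContinuousAt (fun s => Real.exp (H.symm (H (Real.log s) - t))) s :=
        Real.continuous_exp.continuousAt.comp (H.symm.continuous.continuousAt.comp
          ((H.continuous.continuousAt.comp (Real.continuousAt_log hs.ne')).sub continuousAt_const))
      refine h.congr ?_
      filter_upwards [lt_mem_nhds hs] with s hs
      exact (flowKL_of_pos H hs t).symm
  · exact (Real.exp_pos _).trans_eq (flowKL_of_pos H hs t).symm
  · intro a ha b _ hab
    have hb : 0 < b := lt_of_le_of_lt ha hab
    simp only
    rw [flowKL_of_pos H hb]
    rcases (mem_Ici.1 ha).eq_or_lt with rfl | ha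
    · rw [flowKL_zero]
      exact Real.exp_pos _
    · rw [flowKL_of_pos H ha, Real.exp_lt_exp, H.symm.lt_iff_lt]
      exact sub_lt_sub_right (H.lt_iff_lt.2 (Real.log_lt_log ha hab)) t
  · have h : Tendsto (fun s => Real.exp (H.symm (H (Real.log s) - t))) atTop atTop :=
      Real.tendsto_exp_atTop.comp (H.symm.tendsto_atTop.comp
        (tendsto_atTop_add_const_right _ _ (H.tendsto_atTop.comp Real.tendsto_log_atTop)))
    refine h.congr' ?_
    filter_upwards [eventually_gt_atTop 0] with s hs
    exact (flowKL_of_pos H hs t).symm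
  · intro a _ b _ hab
    rw [flowKL_of_pos H hs, flowKL_of_pos H hs, Real.exp_lt_exp, H.symm.lt_iff_lt]
    exact sub_lt_sub_left hab _
  · have h : Tendsto (fun t => Real.exp (H.symm (H (Real.log s) - t))) atTop (𝓝 0) :=
      Real.tendsto_exp_atBot.comp (H.symm.tendsto_atBot.comp
        (tendsto_atBot_add_const_left _ _ tendsto_neg_atTop_atBot))
    exact h.congr fun t => (flowKL_of_pos H hs t).symm

lemma classKInf_sq_add_mul {k : ℝ} (hk : 0 ≤ k) : ClassKInf fun s => s ^ 2 + k * s := by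
  refine ⟨⟨⟨by fun_prop, by simp, fun s hs => by positivity⟩, fun a ha b hb hab => ?_⟩, ?_⟩
  · have ha' : 0 ≤ a := ha
    have := mul_le_mul_of_nonneg_left hab.le hk
    simp only
    nlinarith
  · refine tendsto_atTop_mono' _ ?_ (tendsto_pow_atTop (two_ne_zero) : Tendsto _ _ _)
    filter_upwards [eventually_ge_atTop 0] with s hs
    have := mul_nonneg hk hs
    linarith

/-! ### Behaviour along solutions -/

lemma eventually_lt_add_mul_of_hasDerivWithinAt {a : ℝ → ℝ} {a' t M r : ℝ}
    (ha : HasDerivWithinAt a a' (Ici t) t) (hM : a t ≤ M) (hr : a t = M → a' < r) :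
    ∀ᶠ z in 𝓝[>] t, a z < M + r * (z - t) := by
  rcases hM.eq_or_lt with hM | hM
  · have hs := (hasDerivWithinAt_iff_tendsto_slope' self_notMem_Ioi).1 ha.Ioi_of_Ici
    filter_upwards [hs.eventually_lt_const (hr hM), self_mem_nhdsWithin] with z hz hzt
    have hzt' : 0 < z - t := sub_pos.2 hzt
    rw [slope_def_field, div_lt_iff₀ hzt', hM] at hz
    linarith
  · have hcont : ContinuousWithinAt (fun z => a z - (M + r * (z - t))) (Ioi t) t :=
      (ha.continuousWithinAt.mono Ioi_subset_Ici_self).sub (by fun_prop)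
    have h0 : a t - (M + r * (t - t)) < 0 := by simpa using hM
    filter_upwards [hcont.eventually_lt_const h0] with z hz
    linarith

/-- Only the functions active at `t` contribute to the upper right Dini derivative of a maximum. -/
lemma eventually_slope_max_lt {a b : ℝ → ℝ} {a' b' t c r : ℝ}
    (ha : HasDerivWithinAt a a' (Ici t) t) (hb : HasDerivWithinAt b b' (Ici t) t)
    (hac : b t ≤ a t → a' ≤ c) (hbc : a t ≤ b t → b' ≤ c) (hr : c < r) :
    ∀ᶠ z in 𝓝[>] t, slope (fun z => max (a z) (b z)) t z < r := by
  filter_upwards [eventually_lt_add_mul_of_hasDerivWithinAt ha (le_max_left _ (b t))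
      fun h => (hac (max_eq_left_iff.1 h.symm)).trans_lt hr,
    eventually_lt_add_mul_of_hasDerivWithinAt hb (le_max_right (a t) _)
      fun h => (hbc (max_eq_right_iff.1 h.symm)).trans_lt hr, self_mem_nhdsWithin] with z h1 h2 hzt
  have hzt' : 0 < z - t := sub_pos.2 hzt
  rw [slope_def_field, div_lt_iff₀ hzt']
  linarith [max_lt h1 h2]

section Solutions

variable {n : ℕ} {F : Euc n → Euc n} {X : Set (Euc n)} {T : ℝ} {x : ℝ → Euc n}

lemma IsSolution.continuousOn {J : Set ℝ} (hx : IsSolution F X J x) : ContinuousOn x J :=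
  fun t ht => (hx t ht).2.continuousWithinAt

lemma IsSolution.hasDerivWithinAt_Ici (hx : IsSolution F X (Icc 0 T) x) {t : ℝ}
    (ht : t ∈ Ico 0 T) : HasDerivWithinAt x (F (x t)) (Ici t) t :=
  ((hx t (Ico_subset_Icc_self ht)).2.mono (Icc_subset_Icc_left ht.1)).mono_of_mem_nhdsWithin
    (Icc_mem_nhdsGE ht.2)

lemma IsSolution.hasDerivWithinAt_comp (hx : IsSolution F X (Icc 0 T) x) {t : ℝ}
    (ht : t ∈ Ico 0 T) {h : Euc n → ℝ} {a : Euc n} (hh : HasGradientAt h a (x t)) :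
    HasDerivWithinAt (fun z => h (x z)) (inner ℝ a (F (x t))) (Ici t) t :=
  (hh.hasFDerivAt.comp_hasDerivWithinAt t (hx.hasDerivWithinAt_Ici ht)).congr_deriv (by simp)

/-- A vector field that points out of a ball on the bounding sphere cannot carry a solution into
the ball. -/
lemma IsSolution.le_norm_sub {xc : Euc n} {s : ℝ} (hx : IsSolution F X (Icc 0 T) x) (hs : 0 ≤ s)
    (hout : ∀ y ∈ X, ‖y - xc‖ = s → 0 < inner ℝ (y - xc) (F y)) (h0 : s ≤ ‖x 0 - xc‖) :
    ∀ t ∈ Icc 0 T, s ≤ ‖x t - xc‖ := by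
  intro t ht
  -- `barB xc 1 0` is minus the square of the distance to `xc`
  have key : barB xc 1 0 (x t) ≤ -s ^ 2 := by
    refine image_le_of_deriv_right_lt_deriv_boundary' (f := fun z => barB xc 1 0 (x z))
      (B := fun _ => -s ^ 2) (B' := fun _ => 0)
      ((continuous_barB xc 1 0).comp_continuousOn hx.continuousOn)
      (fun z hz => hx.hasDerivWithinAt_comp hz (hasGradientAt_barB xc 1 0 (x z)))
      ?_ continuousOn_const (fun z _ => hasDerivWithinAt_const _ _ _) (fun z hz hzs => ?_) ht
    · simp only [barB]
      nlinarith
    · have hsq : ‖x z - xc‖ ^ 2 = s ^ 2 := by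
        simp only [barB] at hzs
        linarith
      have := hout _ (hx z (Ico_subset_Icc_self hz)).1
        ((pow_left_inj₀ (norm_nonneg _) hs two_ne_zero).1 hsq)
      rw [real_inner_smul_left]
      linarith
  simp only [barB] at key
  exact (pow_le_pow_iff_left₀ hs (norm_nonneg _) two_ne_zero).1 (by linarith)

variable {xc : Euc n} {η₁ η₂ : ℝ} {ρ : ℝ → ℝ}

lemma IsSolution.eventually_slope_maxV_lt (hx : IsSolution F X (Icc 0 T) x) {t c r : ℝ}
    (ht : t ∈ Ico 0 T)
    (hL : barB xc η₁ η₂ (x t) ≤ lyapL (x t) → deriv₂ F (x t) ≤ c)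
    (hB : lyapL (x t) ≤ barB xc η₁ η₂ (x t) → deriv₁ F xc η₁ η₂ (x t) ≤ c) (hr : c < r) :
    ∀ᶠ z in 𝓝[>] t, slope (fun z => maxV xc η₁ η₂ (x z)) t z < r := by
  rw [deriv₂_eq] at hL
  rw [deriv₁_eq] at hB
  exact eventually_slope_max_lt (hx.hasDerivWithinAt_comp ht (hasGradientAt_lyapL _))
    (hx.hasDerivWithinAt_comp ht (hasGradientAt_barB xc η₁ η₂ _)) hL hB hr

lemma norm_sq_le_maxV (y : Euc n) : ‖y‖ ^ 2 ≤ maxV xc η₁ η₂ y := le_max_left _ _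

/-- The decay estimate: `V` decreases along the solution at the rate `ρ`, hence stays below a
solution of a scalar comparison equation with a smaller rate of decrease. -/
lemma IsSolution.norm_le_flowKL (hx : IsSolution F X (Icc 0 T) x) {k : ℝ} {q : ℝ → ℝ}
    {H : ℝ ≃o ℝ} (hVk : ∀ y, maxV xc η₁ η₂ y ≤ ‖y‖ ^ 2 + 2 * k * ‖y‖) (hρ : ClassP ρ)
    (hq1 : ∀ y, 1 ≤ q y)
    (hq : ∀ y s, 0 ≤ s → s ≤ Real.exp y → Real.exp y ^ 2 ≤ s ^ 2 + 2 * k * s →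
      2 * Real.exp y ^ 2 < q y * ρ s)
    (hH : ∀ z, HasDerivAt H.symm (q (H.symm z))⁻¹ z)
    (hL : ∀ t ∈ Ico 0 T, barB xc η₁ η₂ (x t) ≤ lyapL (x t) → deriv₂ F (x t) ≤ -ρ ‖x t‖)
    (hB : ∀ t ∈ Ico 0 T, lyapL (x t) ≤ barB xc η₁ η₂ (x t) →
      deriv₁ F xc η₁ η₂ (x t) ≤ -ρ ‖x t‖)
    (h0 : maxV xc η₁ η₂ (x 0) ≤ ‖x 0‖ ^ 2) {t : ℝ} (ht : t ∈ Icc 0 T) :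
    ‖x t‖ ≤ flowKL H ‖x 0‖ t := by
  have hcont : ContinuousOn (fun z => maxV xc η₁ η₂ (x z)) (Icc 0 T) :=
    (continuous_lyapL.max (continuous_barB xc η₁ η₂)).comp_continuousOn hx.continuousOn
  have hslope : ∀ t ∈ Ico 0 T, ∀ r, -ρ ‖x t‖ < r →
      ∃ᶠ z in 𝓝[>] t, slope (fun z => maxV xc η₁ η₂ (x z)) t z < r := fun t ht r hr =>
    (hx.eventually_slope_maxV_lt ht (hL t ht) (hB t ht) hr).frequently
  rcases (norm_nonneg (x 0)).eq_or_lt with hx0 | hx0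
  · rw [← hx0, flowKL_zero]
    have hρ0 : ∀ y : Euc n, 0 ≤ ρ ‖y‖ := fun y => by
      rcases (norm_nonneg y).eq_or_lt with h | h
      · rw [← h, hρ.2.1]
      · exact (hρ.2.2 _ h).le
    have key : maxV xc η₁ η₂ (x t) ≤ 0 :=
      image_le_of_liminf_slope_right_le_deriv_boundary (B := fun _ => 0) (B' := fun _ => 0)
        hcont (by simpa [← hx0] using h0) continuousOn_const
        (fun z _ => hasDerivWithinAt_const _ _ _)
        (fun z hz r hr => hslope z hz r (by linarith [hρ0 (x z)])) ht
    have := (norm_sq_le_maxV (x t)).trans key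
    nlinarith [norm_nonneg (x t)]
  · rw [flowKL_of_pos H hx0]
    set y : ℝ → ℝ := fun z => H.symm (H (Real.log ‖x 0‖) - z) with hy
    have hyd : ∀ z, HasDerivAt y (-(q (y z))⁻¹) z := fun z =>
      ((hH (H (Real.log ‖x 0‖) - z)).comp z ((hasDerivAt_id z).const_sub _)).congr_deriv
        (by simp [hy])
    have hBd : ∀ z, HasDerivAt (fun z => Real.exp (y z) ^ 2)
        (-(2 * Real.exp (y z) ^ 2 / q (y z))) z := fun z =>
      ((hyd z).exp.fun_pow 2).congr_deriv (by push_cast; ring)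
    have key : maxV xc η₁ η₂ (x t) ≤ Real.exp (y t) ^ 2 := by
      refine image_le_of_liminf_slope_right_lt_deriv_boundary hcont hslope ?_ hBd
        (fun z hz hzy => ?_) ht
      · simpa [hy, Real.exp_log hx0] using h0
      · have hqz : 0 < q (y z) := zero_lt_one.trans_le (hq1 _)
        rw [neg_lt_neg_iff, div_lt_iff₀' hqz]
        refine hq _ _ (norm_nonneg _) ?_ (hzy ▸ hVk _)
        refine (pow_le_pow_iff_left₀ (norm_nonneg _) (Real.exp_pos _).le two_ne_zero).1 ?_
        exact hzy ▸ norm_sq_le_maxV (x z)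
    exact (pow_le_pow_iff_left₀ (norm_nonneg _) (Real.exp_pos _).le two_ne_zero).1
      ((norm_sq_le_maxV (x t)).trans key)

end Solutions

/-! ### Global existence of bounded solutions -/

section Existence

lemma exists_lipschitzWith_retraction {E : Type*} [NormedAddCommGroup E] [InnerProductSpace ℝ E]
    [CompleteSpace E] {K : Set E} (hne : K.Nonempty) (hcl : IsClosed K) (hK : Convex ℝ K) :
    ∃ P : E → E, LipschitzWith 1 P ∧ (∀ x, P x ∈ K) ∧ ∀ x ∈ K, P x = x := by
  have hP : ∀ x, ∃ v ∈ K, ∀ w ∈ K, inner ℝ (x - v) (w - v) ≤ 0 := fun x => by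
    obtain ⟨v, hv, hmin⟩ := exists_norm_eq_iInf_of_complete_convex hne hcl.isComplete hK x
    exact ⟨v, hv, (norm_eq_iInf_iff_real_inner_le_zero hK hv).1 hmin⟩
  choose P hPK hPi using hP
  refine ⟨P, LipschitzWith.of_dist_le_mul fun x y => ?_, hPK, fun x hx => ?_⟩
  · rw [dist_eq_norm, dist_eq_norm, NNReal.coe_one, one_mul]
    have h1 := hPi x (P y) (hPK y)
    have h2 := hPi y (P x) (hPK x)
    have h3 : ‖P x - P y‖ ^ 2 ≤ inner ℝ (x - y) (P x - P y) := by
      rw [← real_inner_self_eq_norm_sq]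
      simp only [inner_sub_left, inner_sub_right] at h1 h2 ⊢
      linarith
    have h4 := h3.trans (real_inner_le_norm _ _)
    rcases (norm_nonneg (P x - P y)).eq_or_lt with h | h
    · rw [← h]; exact norm_nonneg _
    · nlinarith
  · have h1 := hPi x x hx
    rw [real_inner_self_eq_norm_sq] at h1
    have : ‖x - P x‖ = 0 := by nlinarith [norm_nonneg (x - P x)]
    exact (sub_eq_zero.1 (norm_eq_zero.1 this)).symm

/-- For a bounded vector field the Picard-Lindelöf theorem gives solutions on intervals of any
length; by uniqueness they fit together. -/
lemma exists_forall_hasDerivWithinAt_Ici {E : Type*} [NormedAddCommGroup E] [NormedSpace ℝ E]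
    [CompleteSpace E] {G : E → E} {K C : NNReal} (hG : LipschitzWith K G) (hC : ∀ x, ‖G x‖ ≤ C)
    (x₀ : E) :
    ∃ x : ℝ → E, x 0 = x₀ ∧ ∀ t ∈ Ici (0 : ℝ), HasDerivWithinAt x (G (x t)) (Ici 0) t := by
  have hex : ∀ N : ℕ, ∃ x : ℝ → E, x 0 = x₀ ∧
      ∀ t ∈ Icc (0 : ℝ) N, HasDerivWithinAt x (G (x t)) (Icc (0 : ℝ) N) t := fun N => by
    have hPL : IsPicardLindelof (fun _ : ℝ => G) (⟨0, le_rfl, N.cast_nonneg⟩ : Icc (0 : ℝ) N) x₀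
        (C * N) 0 C K :=
      { lipschitzOnWith := fun _ _ => hG.lipschitzOnWith
        continuousOn := fun _ _ => continuousOn_const
        norm_le := fun _ _ x _ => hC x
        mul_max_le := by simp }
    exact hPL.exists_eq_forall_mem_Icc_hasDerivWithinAt₀
  choose α hα0 hα using hex
  have hright : ∀ N : ℕ, ∀ t ∈ Ico (0 : ℝ) N, HasDerivWithinAt (α N) (G (α N t)) (Ici t) t :=
    fun N t ht => ((hα N t (Ico_subset_Icc_self ht)).mono
      (Icc_subset_Icc_left ht.1)).mono_of_mem_nhdsWithin (Icc_mem_nhdsGE ht.2)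
  have hcont : ∀ N : ℕ, ContinuousOn (α N) (Icc 0 N) := fun N t ht =>
    (hα N t ht).continuousWithinAt
  have huniq : ∀ N M : ℕ, N ≤ M → EqOn (α N) (α M) (Icc 0 N) := fun N M hNM => by
    have hNM' : (N : ℝ) ≤ M := Nat.cast_le.2 hNM
    exact ODE_solution_unique (v := fun _ => G) (fun _ => hG) (hcont N) (hright N)
      ((hcont M).mono (Icc_subset_Icc_right hNM'))
      (fun t ht => hright M t ⟨ht.1, ht.2.trans_le hNM'⟩) ((hα0 N).trans (hα0 M).symm)
  refine ⟨fun t => α (⌊t⌋₊ + 1) t, by simpa using hα0 1, fun t ht => ?_⟩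
  set N := ⌊t⌋₊ + 1 with hN
  have htN : t < N := by rw [hN]; exact_mod_cast Nat.lt_floor_add_one t
  have heq : ∀ s ∈ Ico (0 : ℝ) N, α (⌊s⌋₊ + 1) s = α N s := fun s hs => by
    refine huniq _ _ ?_ ⟨hs.1, by exact_mod_cast (Nat.lt_floor_add_one s).le⟩
    exact (Nat.floor_lt hs.1).2 hs.2
  have hnhds : Ico (0 : ℝ) N ∈ 𝓝[Ici 0] t := by
    rw [← Ici_inter_Iio]
    exact inter_mem_nhdsWithin _ (Iio_mem_nhds htN)
  refine HasDerivWithinAt.congr_of_eventuallyEq ?_ (mem_of_superset hnhds heq) rfl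
  exact (hα N t ⟨ht, htN.le⟩).mono_of_mem_nhdsWithin (mem_of_superset hnhds Ico_subset_Icc_self)

/-- Solutions of a locally Lipschitz system that satisfy an a priori bound exist for all times. -/
lemma exists_isSolution_Ici {n : ℕ} {F : Euc n → Euc n} (hF : LocallyLipschitz F) {x₀ : Euc n}
    {M : ℝ} (hM : ∀ (T : ℝ) (x : ℝ → Euc n), 0 ≤ T → IsSolution F univ (Icc 0 T) x → x 0 = x₀ →
      ∀ t ∈ Icc 0 T, ‖x t‖ ≤ M) :
    ∃ x : ℝ → Euc n, IsSolution F univ (Ici 0) x ∧ x 0 = x₀ := by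
  have hx₀ : ‖x₀‖ ≤ M := hM 0 (fun _ => x₀) le_rfl
    (fun t _ => ⟨mem_univ _, HasFDerivWithinAt.of_subsingleton (by simp)⟩) rfl 0 (by simp)
  have hM0 : 0 ≤ M := (norm_nonneg _).trans hx₀
  -- `F ∘ P` is bounded and Lipschitz, and agrees with `F` on a ball that no solution leaves
  set D : Set (Euc n) := Metric.closedBall 0 (M + 1) with hD
  have hDc : IsCompact D := isCompact_closedBall _ _
  obtain ⟨P, hP1, hPD, hPid⟩ := exists_lipschitzWith_retraction
    (Metric.nonempty_closedBall.2 (by linarith) : D.Nonempty) hDc.isClosed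
    (convex_closedBall _ _)
  obtain ⟨K, hK⟩ := (hF.locallyLipschitzOn (s := D)).exists_lipschitzOnWith_of_compact hDc
  obtain ⟨C, hC⟩ := hDc.exists_bound_of_continuousOn hF.continuous.continuousOn
  have hG : LipschitzWith (K * 1) (F ∘ P) := by
    rw [← lipschitzOnWith_univ]
    exact hK.comp hP1.lipschitzOnWith fun x _ => hPD x
  have hGC : ∀ x, ‖(F ∘ P) x‖ ≤ C.toNNReal := fun x => (hC _ (hPD x)).trans (Real.le_coe_toNNReal C)
  obtain ⟨x, hx0, hx⟩ := exists_forall_hasDerivWithinAt_Ici hG hGC x₀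
  have hxc : ContinuousOn (fun t => ‖x t‖) (Ici 0) := fun t ht =>
    (hx t ht).continuousWithinAt.norm
  have hmem : ∀ T, (∀ t ∈ Icc 0 T, ‖x t‖ ≤ M + 1) → IsSolution F univ (Icc 0 T) x :=
    fun T hT t ht => by
      have hid := hPid (x t) (by simpa [hD] using hT t ht)
      have := (hx t ht.1).mono (Icc_subset_Ici_self : Icc 0 T ⊆ Ici 0)
      rw [Function.comp_apply, hid] at this
      exact ⟨mem_univ _, this⟩
  have hbound : ∀ t ∈ Ici (0 : ℝ), ‖x t‖ ≤ M + 1 := by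
    intro t ht
    by_contra! hlt
    -- the first time at which the norm is `M + 1`
    set S : Set ℝ := Icc 0 t ∩ (fun t => ‖x t‖) ⁻¹' {M + 1} with hS
    have hct : ContinuousOn (fun t => ‖x t‖) (Icc 0 t) := hxc.mono Icc_subset_Ici_self
    have hSc : IsCompact S := isCompact_Icc.of_isClosed_subset
      (hct.preimage_isClosed_of_isClosed isClosed_Icc isClosed_singleton) inter_subset_left
    have hSne : S.Nonempty := by
      obtain ⟨s, hs, hs'⟩ := intermediate_value_Icc (mem_Ici.1 ht) hct
        (show M + 1 ∈ Icc ‖x 0‖ ‖x t‖ from ⟨by rw [hx0]; linarith, hlt.le⟩)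
      exact ⟨s, hs, hs'⟩
    obtain ⟨τ, hτ, hmin⟩ := hSc.exists_isLeast hSne
    have hle : ∀ s ∈ Icc 0 τ, ‖x s‖ ≤ M + 1 := by
      intro s hs
      by_contra! hlt'
      obtain ⟨u, hu, hu'⟩ := intermediate_value_Icc hs.1
        (hct.mono (Icc_subset_Icc_right (hs.2.trans hτ.1.2)))
        (show M + 1 ∈ Icc ‖x 0‖ ‖x s‖ from ⟨by rw [hx0]; linarith, hlt'.le⟩)
      have hτu : τ ≤ u := hmin ⟨⟨hu.1, hu.2.trans (hs.2.trans hτ.1.2)⟩, hu'⟩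
      have hsu : s = u := le_antisymm (hs.2.trans hτu) hu.2
      rw [hsu] at hlt'
      exact hlt'.ne' hu'
    have h1 := hM τ x hτ.1.1 (hmem τ hle) hx0 τ ⟨hτ.1.1, le_rfl⟩
    have h2 : ‖x τ‖ = M + 1 := hτ.2
    linarith
  refine ⟨x, fun t ht => ⟨mem_univ _, ?_⟩, hx0⟩
  have hid := hPid (x t) (by simpa [hD] using hbound t ht)
  have := hx t ht
  rwa [Function.comp_apply, hid] at this

end Existence

/-! ### The nonsmooth control Lyapunov barrier function of a ball -/

section Main

variable {n : ℕ} {X : Set (Euc n)} {xc : Euc n} {r η₁ η₂ : ℝ}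

lemma unsafeBall_eq_ball (hxc : √r ≤ ‖xc‖) (hball : Metric.ball xc (√r) ⊆ X) :
    unsafeBall X xc r = Metric.ball xc (√r) := by
  ext x
  rw [mem_ball_iff_norm]
  refine ⟨fun h => h.2, fun h => ⟨⟨hball (mem_ball_iff_norm.2 h), ?_⟩, h⟩⟩
  rintro rfl
  rw [zero_sub, norm_neg] at h
  exact absurd h (not_lt.2 hxc)

lemma isNCLBFCandidate_maxV (hr : 0 < r) (hη₁ : 0 < η₁) (hxc : √r < ‖xc‖)
    (hball : Metric.ball xc (√r) ⊆ X)
    (hη₂ : ∀ x ∈ Metric.closedBall xc (√r), η₁ * r + lyapL x ≤ η₂)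
    (hη₂' : η₂ ≤ η₁ * ‖xc‖ ^ 2) :
    IsNCLBFCandidate X 0 (fun _ : Fin 1 => unsafeBall X xc r) (maxV xc η₁ η₂) := by
  have hs : √r ^ 2 = r := Real.sq_sqrt hr.le
  have hs0 : 0 < √r := Real.sqrt_pos.2 hr
  refine ⟨locallyLipschitz_maxV _ _ _, ⟨fun _ => η₂ - η₁ * r, fun _ => ⟨?_, fun x hx => ?_,
    fun x hx => ?_⟩⟩, fun s => s ^ 2 + 0 * s, fun s => s ^ 2 + 2 * (η₁ * ‖xc‖) * s,
    classKInf_sq_add_mul le_rfl, classKInf_sq_add_mul (by positivity), fun x _ => ⟨?_, ?_⟩⟩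
  · have h := hη₂ xc (Metric.mem_closedBall_self hs0.le)
    have : 0 < lyapL xc := pow_pos (hs0.trans hxc) 2
    linarith
  · rw [unsafeBall_eq_ball hxc.le hball, frontier_ball _ hs0.ne'] at hx
    have h := hη₂ x (Metric.sphere_subset_closedBall hx)
    rw [mem_sphere_iff_norm] at hx
    have hB : barB xc η₁ η₂ x = η₂ - η₁ * r := by rw [barB, hx, hs]
    rw [maxV, hB]
    exact max_eq_right (by linarith)
  · have hlt : ‖x - xc‖ ^ 2 < √r ^ 2 := pow_lt_pow_left₀ hx.2 (norm_nonneg _) two_ne_zero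
    refine le_trans ?_ (le_max_right _ _)
    rw [hs] at hlt
    rw [barB]
    have := mul_le_mul_of_nonneg_left hlt.le hη₁.le
    linarith
  · simpa using norm_sq_le_maxV x
  · simpa using maxV_le hη₁.le hη₂' x

variable {F : Euc n → Euc n} {ρ : ℝ → ℝ} {O : Set (Euc n)}

lemma Decreases.deriv₂_le (hρ0 : ρ 0 = 0) (hη₁ : 0 < η₁) (hη₂ : ‖xc‖ ^ 2 < η₂)
    (hdec : Decreases (singleValued F) X 0 O (maxV xc η₁ η₂) ρ) {y : Euc n} (hy : y ∈ X)
    (hyO : y ∉ O) (hBL : barB xc η₁ η₂ y ≤ lyapL y) : deriv₂ F y ≤ -ρ ‖y‖ := by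
  rcases eq_or_ne y 0 with rfl | hy0
  · simp [deriv₂_eq, hρ0]
  have h := hdec y ⟨hy, by simp [hyO, hy0]⟩
  rcases hBL.eq_or_lt with heq | hlt
  · rw [upperGenDeriv_maxV_of_eq F hη₁ hη₂ heq, EReal.coe_le_coe_iff, deriv₃_eq_max] at h
    exact (le_max_left _ _).trans h
  · rwa [upperGenDeriv_maxV_of_gt F hlt, EReal.coe_le_coe_iff] at h

lemma Decreases.deriv₁_le (hη₁ : 0 < η₁) (hη₂ : ‖xc‖ ^ 2 < η₂) (hη₂' : η₂ < η₁ * ‖xc‖ ^ 2)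
    (hdec : Decreases (singleValued F) X 0 O (maxV xc η₁ η₂) ρ) {y : Euc n} (hy : y ∈ X)
    (hyO : y ∉ O) (hLB : lyapL y ≤ barB xc η₁ η₂ y) :
    y ≠ 0 ∧ deriv₁ F xc η₁ η₂ y ≤ -ρ ‖y‖ := by
  have hy0 : y ≠ 0 := by
    rintro rfl
    simp only [lyapL, barB, norm_zero, zero_sub, norm_neg] at hLB
    linarith
  refine ⟨hy0, ?_⟩
  have h := hdec y ⟨hy, by simp [hyO, hy0]⟩
  rcases hLB.eq_or_lt with heq | hlt
  · rw [upperGenDeriv_maxV_of_eq F hη₁ hη₂ heq.symm, EReal.coe_le_coe_iff, deriv₃_eq_max] at h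
    exact (le_max_right _ _).trans h
  · rwa [upperGenDeriv_maxV_of_lt F hlt, EReal.coe_le_coe_iff] at h

/-- `B ≥ L` on the sphere that bounds the unsafe set, so `B` decreases along the vector field there:
the vector field points out of the unsafe set. -/
lemma Decreases.inner_pos_of_mem_sphere (hρ : ClassP ρ) (hr : 0 ≤ r) (hη₁ : 0 < η₁)
    (hη₂ : ∀ x ∈ Metric.closedBall xc (√r), η₁ * r + lyapL x ≤ η₂) (hη₂c : ‖xc‖ ^ 2 < η₂)
    (hη₂' : η₂ < η₁ * ‖xc‖ ^ 2)
    (hdec : Decreases (singleValued F) X 0 (Metric.ball xc (√r)) (maxV xc η₁ η₂) ρ) {y : Euc n}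
    (hy : y ∈ X) (hyr : ‖y - xc‖ = √r) : 0 < inner ℝ (y - xc) (F y) := by
  have hLB : lyapL y ≤ barB xc η₁ η₂ y := by
    have h := hη₂ y (mem_closedBall_iff_norm.2 hyr.le)
    rw [barB, hyr, Real.sq_sqrt hr]
    linarith
  obtain ⟨hy0, h⟩ := hdec.deriv₁_le hη₁ hη₂c hη₂' hy
    (by rw [mem_ball_iff_norm, hyr]; exact lt_irrefl _) hLB
  have hρy := hρ.2.2 _ (norm_pos_iff.2 hy0)
  rw [deriv₁_eq, real_inner_smul_left] at h
  by_contra! hneg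
  nlinarith [mul_nonneg hη₁.le (neg_nonneg.2 hneg)]

lemma isKLStableAndSafe_of_decreases (hρ : ClassP ρ) (hr : 0 ≤ r) (hη₁ : 0 < η₁)
    (hη₂ : ∀ x ∈ Metric.closedBall xc (√r), η₁ * r + lyapL x ≤ η₂) (hη₂c : ‖xc‖ ^ 2 < η₂)
    (hη₂' : η₂ < η₁ * ‖xc‖ ^ 2)
    (hdec : Decreases (singleValued F) X 0 (Metric.ball xc (√r)) (maxV xc η₁ η₂) ρ)
    {S : Set (Euc n)} (hSO : ∀ y ∈ S, y ∉ Metric.ball xc (√r))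
    (hSV : ∀ y ∈ S, maxV xc η₁ η₂ y ≤ ‖y‖ ^ 2) :
    IsKLStableAndSafe F X (Metric.ball xc (√r)) S := by
  obtain ⟨q, hqc, hq1, hq⟩ := hρ.exists_slow_rate (k := η₁ * ‖xc‖) (by positivity)
  obtain ⟨H, hH⟩ := exists_orderIso_hasDerivAt hqc hq1
  have hstab : ∀ x₀ ∈ S, ∀ (T : ℝ) (x : ℝ → Euc n), 0 ≤ T → IsSolution F X (Icc 0 T) x →
      x 0 = x₀ → ∀ t ∈ Icc 0 T, ‖x t‖ ≤ flowKL H ‖x₀‖ t ∧ x t ∉ Metric.ball xc (√r) := by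
    rintro _ hx₀ T x hT hx rfl
    have hsafe : ∀ t ∈ Icc 0 T, x t ∉ Metric.ball xc (√r) := fun t ht => by
      rw [mem_ball_iff_norm, not_lt]
      refine hx.le_norm_sub (Real.sqrt_nonneg r)
        (fun y => hdec.inner_pos_of_mem_sphere hρ hr hη₁ hη₂ hη₂c hη₂') ?_ t ht
      exact not_lt.1 fun h => hSO _ hx₀ (mem_ball_iff_norm.2 h)
    refine fun t ht => ⟨?_, hsafe t ht⟩
    exact hx.norm_le_flowKL (maxV_le hη₁.le hη₂'.le) hρ hq1 hq hH
      (fun s hs => hdec.deriv₂_le hρ.2.1 hη₁ hη₂c (hx s (Ico_subset_Icc_self hs)).1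
        (hsafe s (Ico_subset_Icc_self hs)))
      (fun s hs hLB => (hdec.deriv₁_le hη₁ hη₂c hη₂' (hx s (Ico_subset_Icc_self hs)).1
        (hsafe s (Ico_subset_Icc_self hs)) hLB).2)
      (hSV _ hx₀) ht
  refine ⟨flowKL H, classKL_flowKL H, fun x₀ hx₀ => ⟨hstab x₀ hx₀, fun hF hstay => ?_⟩⟩
  have hanti : ∀ t, 0 ≤ t → flowKL H ‖x₀‖ t ≤ flowKL H ‖x₀‖ 0 := fun t ht => by
    rcases (norm_nonneg x₀).eq_or_lt with h | h
    · rw [← h, flowKL_zero, flowKL_zero]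
    · exact ((classKL_flowKL H).2 _ h).1.antitoneOn self_mem_Ici ht ht
  obtain ⟨x, hx, hx0⟩ := exists_isSolution_Ici hF (M := flowKL H ‖x₀‖ 0)
    fun T x hT hx hx0 t ht =>
      ((hstab x₀ hx₀ T x hT
        (fun s hs => ⟨hstay T x hT hx hx0 s hs, (hx s hs).2⟩) hx0 t ht).1).trans (hanti t ht.1)
  refine ⟨x, fun t ht => ⟨?_, (hx t ht).2⟩, hx0⟩
  exact hstay t x ht (fun s hs => ⟨mem_univ _, (hx s hs.1).2.mono Icc_subset_Ici_self⟩) hx0 t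
    ⟨ht, le_rfl⟩

end Main

end SafeStab

theorem theorem1 {n : ℕ} (F : SafeStab.Euc n → SafeStab.Euc n) (X : Set (SafeStab.Euc n))
    (hX0 : (0 : SafeStab.Euc n) ∈ X) (hF0 : F 0 = 0)
    (xc : SafeStab.Euc n) (r : ℝ) (hr : 0 < r) (hxc : √r < ‖xc‖)
    (hball : Metric.ball xc (√r) ⊆ X)
    (η₁ η₂ : ℝ)
    (hη₁ : (‖xc‖ + √r) / (‖xc‖ - √r) ≤ η₁)
    (hη₂ : ∀ x ∈ closure (SafeStab.unsafeBall X xc r), η₁ * r + SafeStab.lyapL x ≤ η₂)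
    (hη₂' : η₂ < η₁ * ‖xc‖ ^ 2) :
    SafeStab.IsNCLBFCandidate X 0 (fun _ : Fin 1 => SafeStab.unsafeBall X xc r)
      (SafeStab.maxV xc η₁ η₂) ∧
    (∀ x ∈ SafeStab.region₁ X xc r η₁ η₂,
      SafeStab.upperGenDeriv (SafeStab.singleValued F) (SafeStab.maxV xc η₁ η₂) x =
        ((SafeStab.deriv₁ F xc η₁ η₂ x : ℝ) : EReal)) ∧
    (∀ x ∈ SafeStab.region₂ X xc η₁ η₂,
      SafeStab.upperGenDeriv (SafeStab.singleValued F) (SafeStab.maxV xc η₁ η₂) x =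
        ((SafeStab.deriv₂ F x : ℝ) : EReal)) ∧
    (∀ x ∈ SafeStab.region₃ X xc η₁ η₂,
      SafeStab.upperGenDeriv (SafeStab.singleValued F) (SafeStab.maxV xc η₁ η₂) x =
        ((SafeStab.deriv₃ F xc η₁ η₂ x : ℝ) : EReal)) ∧
    ∀ ρ : ℝ → ℝ, SafeStab.ClassP ρ →
      SafeStab.Decreases (SafeStab.singleValued F) X 0 (SafeStab.unsafeBall X xc r)
        (SafeStab.maxV xc η₁ η₂) ρ →
      SafeStab.IsNCLBF (SafeStab.singleValued F) X 0
          (fun _ : Fin 1 => SafeStab.unsafeBall X xc r) (SafeStab.maxV xc η₁ η₂) ∧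
        SafeStab.IsKLStableAndSafe F X (SafeStab.unsafeBall X xc r)
          (X \ (SafeStab.unsafeBall X xc r ∪ SafeStab.region₁ X xc r η₁ η₂ ∪
            SafeStab.region₃ X xc η₁ η₂)) := by
  have hs0 : 0 < √r := Real.sqrt_pos.2 hr
  have hη₁0 : 0 < η₁ :=
    lt_of_lt_of_le (div_pos (add_pos (hs0.trans hxc) hs0) (sub_pos.2 hxc)) hη₁
  have hO := SafeStab.unsafeBall_eq_ball hxc.le hball
  rw [hO, closure_ball _ hs0.ne'] at hη₂
  have hη₂c : ‖xc‖ ^ 2 < η₂ := by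
    have h := hη₂ xc (Metric.mem_closedBall_self hs0.le)
    rw [SafeStab.lyapL] at h
    have := mul_pos hη₁0 hr
    linarith
  have hcand := SafeStab.isNCLBFCandidate_maxV hr hη₁0 hxc hball hη₂ hη₂'.le
  refine ⟨hcand, fun x hx => SafeStab.upperGenDeriv_maxV_of_lt F hx.2.1,
    fun x hx => SafeStab.upperGenDeriv_maxV_of_gt F hx.2,
    fun x hx => SafeStab.upperGenDeriv_maxV_of_eq F hη₁0 hη₂c hx.2, fun ρ hρ hdec => ⟨?_, ?_⟩⟩
  · exact ⟨hcand, ρ, hρ, by rwa [Set.iUnion_const]⟩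
  · rw [hO] at hdec ⊢
    refine SafeStab.isKLStableAndSafe_of_decreases hρ hr.le hη₁0 hη₂ hη₂c hη₂' hdec
      (fun y hy hyO => hy.2 (Or.inl (Or.inl hyO))) fun y hy => max_le le_rfl ?_
    by_contra! hlt
    exact hy.2 (Or.inl (Or.inr ⟨hy.1, hlt, fun h => hy.2 (Or.inl (Or.inl (hO ▸ h)))⟩))
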